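/- Let $(i,H,B)$ be an abstract Wiener space: $H$ is a real separable Hilbert space with scalar product $u\cdot x$ and norm $|\cdot|$, $B$ is a real Banach space, $i:H\to B$ is a continuous linear injection with dense range, and the norm of $B$ is measurable, i.e. for all $\varepsilon>0$ and $h>0$ there is a finite-dimensional subspace $F\subset H$ such that $\mu_{E,h}(\{y\in E:\|i(y)\|_B>\varepsilon\})<\varepsilon$ for every finite-dimensional subspace $E\subset H$ orthogonal to $F$, where $\mu_{E,h}$ is the centred Gaussian measure on $E$ with density $(2\pi h)^{-\dim E/2}e^{-|y|^2/(2h)}$. Identify $B'$ with a dense subspace of $H'=H$ through $i$. Let $h>0$. There is exactly one Borel measure $\mu_{B,h}$ on $B$ under which every finite system $u_1,\dots,u_n\in B'$ that is orthonormal in $H$ has the law $N(0,h)^{\otimes n}$. Let $a\mapsto\ell_a$ be the continuous extension to $H$ of the inclusion $B'\to L^2(B,\mu_{B,h})$. For a finite-dimensional subspace $E\subset H$ with orthonormal basis $(u_j)$, put $\widetilde\pi_E(x)=\sum_j\ell_{u_j}(x)u_j$, which is defined for $\mu_{B,h}$-almost every $x\in B$. **Proposition 8.6.** Let $\nu$ be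 a bounded complex Borel measure on $H$ and let $\widehat\nu(x)=\int_H e^{iu\cdot x}\,d\nu(u)$ for $x\in H$. Then for every $h>0$ the function $\widehat\nu$ is Borel and admits a stochastic extension for $\mu_{B,h}$, and it does so in the sense of $L^2(B,\mu_{B,h})$. That is, there is a function $\widetilde\nu\in L^2(B,\mu_{B,h})$ such that, for every increasing sequence $(E_n)$ of finite-dimensional subspaces of $H$ whose union is dense in $H$, the functions $\widehat\nu\circ\widetilde\pi_{E_n}$ belong to $L^2(B,\mu_{B,h})$ and converge to $\widetilde\nu$ in $L^2(B,\mu_{B,h})$ and in probability with respect to $\mu_{B,h}$. -/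

import Mathlib

open MeasureTheory ProbabilityTheory Filter Topology
open scoped ENNReal NNReal RealInnerProductSpace

noncomputable section

namespace AbstractWiener

variable {H B : Type*}
  [NormedAddCommGroup H] [InnerProductSpace ℝ H] [MeasurableSpace H]
  [NormedAddCommGroup B] [NormedSpace ℝ B]

/-- The Gaussian measure `μ_{E,h}` on a finite-dimensional subspace `E` of `H`: centred, with
covariance `h` times the scalar product of `H`. It is the law of `√h • Z`, with `Z` standard
Gaussian on `E`, and has density `(2πh)^{-dim E / 2} exp (-|x|² / (2h))` when `h > 0`. -/
def gaussianOn (E : Submodule ℝ H) [FiniteDimensional ℝ E] (h : ℝ) : Measure E :=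
  (stdGaussian E).map (fun z => Real.sqrt h • z)

/-- `(i, H, B)` is an abstract Wiener space (Gross): `i` is a continuous injection with dense
range, and the norm of `B` is measurable. The canonical Gaussian cylinder measure `μ_{H,h}`
of the cylinder set `{x : ‖i (π_E x)‖ > ε} = π_E⁻¹ {y ∈ E : ‖i y‖ > ε}` of `H` is by
definition the `μ_{E,h}`-measure of its base `{y ∈ E : ‖i y‖ > ε}`. -/
structure IsAbstractWienerSpace (i : H →L[ℝ] B) : Prop where
  injective : Function.Injective i
  denseRange : DenseRange i
  measurable_norm : ∀ ε h : ℝ, 0 < ε → 0 < h →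
    ∃ F : Submodule ℝ H, FiniteDimensional ℝ F ∧
      ∀ (E : Submodule ℝ H) [FiniteDimensional ℝ E], E ⟂ F →
        gaussianOn E h {y : E | ε < ‖i (y : H)‖} < ENNReal.ofReal ε

/-- The Fourier transform `ν̂(x) = ∫ e^{i u·x} dν(u)` of a complex measure on `H`. -/
def fourierMeasure (ν : ComplexMeasure H) (x : H) : ℂ :=
  ν.integral (fun u : H => Complex.exp (Complex.I * (⟪u, x⟫ : ℝ))) (ContinuousLinearMap.mul ℝ ℂ)

variable [CompleteSpace H]

/-- The embedding `B' → H' = H` that is dual to `i : H → B`: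
`⟪dualEmbed i u, x⟫ = u (i x)` for `u ∈ B'` and `x ∈ H`. -/
def dualEmbed (i : H →L[ℝ] B) : StrongDual ℝ B →ₗ[ℝ] H where
  toFun u := (InnerProductSpace.toDual ℝ H).symm (u.comp i)
  map_add' u v := by rw [ContinuousLinearMap.add_comp, map_add]
  map_smul' c u := by rw [ContinuousLinearMap.smul_comp, map_smulₛₗ]; rfl

variable [MeasurableSpace B] [BorelSpace B]

/-- `μ` is the Gaussian measure `μ_{B,h}` on the Borel sets of `B`: for every finite system
`u₁, …, uₙ` in `B'` that is orthonormal for the scalar product of `H`, the vector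
`(u₁, …, uₙ)` has the law `N(0,h) ⊗ ⋯ ⊗ N(0,h)` on `ℝⁿ` under `μ`. In other words, `μ` extends
the Gaussian additive function defined on the cylinder sets of `B`. -/
def IsWienerMeasure (i : H →L[ℝ] B) (h : ℝ) (μ : Measure B) : Prop :=
  ∀ (n : ℕ) (u : Fin n → StrongDual ℝ B), Orthonormal ℝ (fun j => dualEmbed i (u j)) →
    μ.map (fun (x : B) (j : Fin n) => u j x) =
      Measure.pi (fun _ : Fin n => gaussianReal 0 h.toNNReal)

/-- The map `a ↦ ℓ_a` from `H` to `L²(B, μ)`: the continuous extension to `H` of the inclusion of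
`B'`, seen as a dense subspace of `H`, into `L²(B, μ)`. -/
def ell (i : H →L[ℝ] B) (μ : Measure B) : H →L[ℝ] Lp ℝ 2 μ :=
  LinearMap.extendOfNorm (StrongDual.toLp μ 2 : StrongDual ℝ B →L[ℝ] Lp ℝ 2 μ).toLinearMap
    (dualEmbed i)

/-- The extension `π̃_E : B → E ⊆ H`, defined `μ`-almost everywhere, of the orthogonal projection
onto the finite-dimensional subspace `E` of `H`: `π̃_E x = ∑ j, ℓ_{u_j}(x) u_j` for an
orthonormal basis `(u_j)` of `E`. -/
def projExt (i : H →L[ℝ] B) (μ : Measure B) (E : Submodule ℝ H) [FiniteDimensional ℝ E]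
    (x : B) : H :=
  ∑ j, (ell i μ (stdOrthonormalBasis ℝ E j : H) : B → ℝ) x • (stdOrthonormalBasis ℝ E j : H)

/-- `g` is a stochastic extension of the Borel function `f : H → ℂ` with respect to `μ`: along
every increasing sequence of finite-dimensional subspaces of `H` with dense union, `f ∘ π̃_{Eₙ}`
converges to `g` in probability. -/
def IsStochasticExtension (i : H →L[ℝ] B) (μ : Measure B) (f : H → ℂ) (g : B → ℂ) : Prop :=
  Measurable f ∧ AEStronglyMeasurable g μ ∧
    ∀ (E : ℕ → Submodule ℝ H) [∀ n, FiniteDimensional ℝ (E n)],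
      Monotone E → Dense (⋃ n, (E n : Set H)) →
        TendstoInMeasure μ (fun n x => f (projExt i μ (E n) x)) atTop g

/-- `g` is a stochastic extension of the Borel function `f : H → ℂ` in the sense of `L^p(B, μ)`:
`g ∈ L^p` and, along every increasing sequence of finite-dimensional subspaces of `H` with dense
union, the functions `f ∘ π̃_{Eₙ}` are in `L^p` and converge to `g` in `L^p`. -/
def IsLpStochasticExtension (i : H →L[ℝ] B) (μ : Measure B) (p : ℝ≥0∞) (f : H → ℂ)
    (g : B → ℂ) : Prop :=
  Measurable f ∧ MemLp g p μ ∧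
    ∀ (E : ℕ → Submodule ℝ H) [∀ n, FiniteDimensional ℝ (E n)],
      Monotone E → Dense (⋃ n, (E n : Set H)) →
        (∀ n, MemLp (fun x => f (projExt i μ (E n) x)) p μ) ∧
          Tendsto (fun n => eLpNorm (fun x => f (projExt i μ (E n) x) - g x) p μ) atTop (𝓝 0)

end AbstractWiener

end

namespace AbstractWiener

/-! Existence of the measure: measurability of the norm, used with ε = 2⁻ⁿ, yields an increasing
exhaustion `G n` of `H` whose successive orthogonal increments carry Gaussians that `i` maps to
vectors of norm at most 2⁻ⁿ outside a set of probability at most 2⁻ⁿ, from the second increment on.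
For independent such Gaussians the series of images converges almost surely (Borel–Cantelli), and by
Pythagoras its law has characteristic functional exp(-h|u|²/2). This functional characterises the
Wiener measure and gives uniqueness.

Extension: almost everywhere ⟪u, π̃_E x⟫ = ℓ_{π_E u}(x), and ‖ℓ_a‖ ≤ √h |a| in L². As r ↦ e^{ir} is
1-Lipschitz, the exponentials for E and F differ in squared L² norm by at most min(4, h|π_E u - π_F
u|²). Cauchy–Schwarz against |ν|, Tonelli and dominated convergence in u then make ν̂ ∘ π̃_{E_m} -
ν̂ ∘ π̃_{F_n} tend to 0 in L² for any two exhausting sequences. Hence a limit exists and does not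
depend on the sequence; L² convergence gives convergence in probability. -/

theorem isFiniteMeasure_variation_signedMeasure {X : Type*} [MeasurableSpace X]
    (s : SignedMeasure X) : IsFiniteMeasure s.variation := by
  rw [← SignedMeasure.totalVariation_eq_variation]
  infer_instance

/-- Since |ν(s)| ≤ |Re ν(s)| + |Im ν(s)|, the variation is dominated by those of the real and
imaginary parts. Finiteness is what permits dominated convergence and Cauchy–Schwarz against |ν|. -/
instance isFiniteMeasure_variation_complexMeasure {X : Type*} [MeasurableSpace X]
    (ν : ComplexMeasure X) : IsFiniteMeasure ν.variation := by
  have := isFiniteMeasure_variation_signedMeasure (ComplexMeasure.re ν)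
  have := isFiniteMeasure_variation_signedMeasure (ComplexMeasure.im ν)
  refine isFiniteMeasure_of_le
    ((ComplexMeasure.re ν).variation + (ComplexMeasure.im ν).variation) ?_
  refine VectorMeasure.variation_le_of_forall_enorm_le fun s _ => ?_
  rw [Measure.add_apply]
  calc ‖ν s‖ₑ = ‖((ν s).re : ℂ) + (ν s).im * Complex.I‖ₑ := by rw [Complex.re_add_im]
    _ ≤ ‖((ν s).re : ℂ)‖ₑ + ‖((ν s).im : ℂ) * Complex.I‖ₑ := enorm_add_le _ _
    _ = ‖(ComplexMeasure.re ν) s‖ₑ + ‖(ComplexMeasure.im ν) s‖ₑ := by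
      congr 1 <;> simp [← ofReal_norm] <;> rfl
    _ ≤ _ := add_le_add (VectorMeasure.enorm_measure_le_variation _ _)
      (VectorMeasure.enorm_measure_le_variation _ _)

/-! ### Fourier transform of a complex measure -/

section Fourier

variable {H : Type*} [NormedAddCommGroup H] [InnerProductSpace ℝ H] [MeasurableSpace H]
  [BorelSpace H]

theorem norm_exp_I_mul_ofReal (r : ℝ) : ‖Complex.exp (Complex.I * (r : ℂ))‖ = 1 := by
  rw [mul_comm, Complex.norm_exp_ofReal_mul_I]

theorem norm_exp_I_mul_ofReal_sub_le (r s : ℝ) :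
    ‖Complex.exp (Complex.I * (r : ℂ)) - Complex.exp (Complex.I * (s : ℂ))‖ ≤ |r - s| := by
  have h1 : Complex.exp (Complex.I * (r : ℂ)) - Complex.exp (Complex.I * (s : ℂ)) =
      Complex.exp (Complex.I * (s : ℂ)) * (Complex.exp (Complex.I * ((r - s : ℝ) : ℂ)) - 1) := by
    rw [mul_sub, ← Complex.exp_add]
    push_cast
    ring_nf
  rw [h1, norm_mul, norm_exp_I_mul_ofReal, one_mul]
  exact Real.norm_exp_I_mul_ofReal_sub_one_le

theorem integrable_exp_inner (ν : ComplexMeasure H) (x : H) :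
    ν.Integrable (fun u : H => Complex.exp (Complex.I * (⟪u, x⟫ : ℝ))) := by
  refine Integrable.of_bound (C := 1) (Continuous.aestronglyMeasurable (by fun_prop)) ?_
  exact ae_of_all _ fun u => (norm_exp_I_mul_ofReal _).le

theorem continuous_fourierMeasure (ν : ComplexMeasure H) : Continuous (fourierMeasure ν) := by
  rw [continuous_iff_continuousAt]
  intro x
  refine VectorMeasure.continuousAt_of_dominated (bound := fun _ => 1) ?_ ?_
    (integrable_const _) ?_
  · exact Eventually.of_forall fun y => (integrable_exp_inner ν y).aestronglyMeasurable
  · exact Eventually.of_forall fun y => ae_of_all _ fun u => (norm_exp_I_mul_ofReal _).le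
  · exact ae_of_all _ fun u => Continuous.continuousAt (by fun_prop)

theorem enorm_fourierMeasure_sub_le (ν : ComplexMeasure H) (x y : H) :
    ‖fourierMeasure ν x - fourierMeasure ν y‖ₑ ≤
      ∫⁻ u, ‖Complex.exp (Complex.I * (⟪u, x⟫ : ℝ)) -
        Complex.exp (Complex.I * (⟪u, y⟫ : ℝ))‖ₑ ∂ν.variation := by
  unfold fourierMeasure
  rw [← VectorMeasure.integral_fun_sub (integrable_exp_inner ν x) (integrable_exp_inner ν y)]
  refine (VectorMeasure.enorm_integral_le_lintegral_enorm).trans ?_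
  have h1 : ‖ContinuousLinearMap.mul ℝ ℂ‖ₑ ≤ 1 := by
    rw [← ofReal_norm]
    simp
  grw [h1, one_mul]

omit [BorelSpace H] in
theorem norm_fourierMeasure_le (ν : ComplexMeasure H) (x : H) :
    ‖fourierMeasure ν x‖ ≤ ν.variation.real Set.univ := by
  refine (VectorMeasure.norm_integral_le_integral_norm).trans ?_
  simp_rw [norm_exp_I_mul_ofReal]
  simp

theorem sq_lintegral_le {X : Type*} [MeasurableSpace X] (m : Measure X) (f : X → ℝ≥0∞)
    (hf : AEMeasurable f m) : (∫⁻ x, f x ∂m) ^ 2 ≤ m Set.univ * ∫⁻ x, f x ^ 2 ∂m := by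
  have h := ENNReal.lintegral_mul_le_Lp_mul_Lq m Real.HolderConjugate.two_two
    (aemeasurable_const (b := (1 : ℝ≥0∞))) hf
  simp only [Pi.mul_apply, one_mul, ENNReal.one_rpow, lintegral_const] at h
  calc (∫⁻ x, f x ∂m) ^ 2 ≤ (m Set.univ ^ (1 / 2 : ℝ) *
        (∫⁻ x, f x ^ (2 : ℝ) ∂m) ^ (1 / 2 : ℝ)) ^ 2 := by gcongr
    _ = _ := by
      rw [mul_pow, ← ENNReal.rpow_natCast, ← ENNReal.rpow_natCast, ← ENNReal.rpow_mul,
        ← ENNReal.rpow_mul]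
      norm_num

variable [SecondCountableTopology H]

/-- Cauchy–Schwarz against the constant 1 costs the total mass of |ν|; Tonelli then leaves, for each
fixed `u`, a scalar problem on `Ω`. -/
theorem lintegral_fourierMeasure_sub_sq_le {Ω : Type*} [MeasurableSpace Ω] (μ : Measure Ω)
    [SFinite μ] (ν : ComplexMeasure H) (X Y : Ω → H) (hX : Measurable X) (hY : Measurable Y) :
    ∫⁻ ω, ‖fourierMeasure ν (X ω) - fourierMeasure ν (Y ω)‖ₑ ^ 2 ∂μ ≤
      ν.variation Set.univ * ∫⁻ u, ∫⁻ ω, ‖Complex.exp (Complex.I * (⟪u, X ω⟫ : ℝ)) -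
        Complex.exp (Complex.I * (⟪u, Y ω⟫ : ℝ))‖ₑ ^ 2 ∂μ ∂ν.variation := by
  have hm : Measurable fun p : Ω × H => ‖Complex.exp (Complex.I * (⟪p.2, X p.1⟫ : ℝ)) -
        Complex.exp (Complex.I * (⟪p.2, Y p.1⟫ : ℝ))‖ₑ := by
    fun_prop
  calc _ ≤ ∫⁻ ω, (ν.variation Set.univ * ∫⁻ u, ‖Complex.exp (Complex.I * (⟪u, X ω⟫ : ℝ)) -
        Complex.exp (Complex.I * (⟪u, Y ω⟫ : ℝ))‖ₑ ^ 2 ∂ν.variation) ∂μ := by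
        refine lintegral_mono fun ω => ?_
        grw [enorm_fourierMeasure_sub_le]
        exact sq_lintegral_le _ _ (hm.comp measurable_prodMk_left).aemeasurable
    _ = _ := by
      rw [lintegral_const_mul' _ _ (measure_ne_top _ _), lintegral_lintegral_swap]
      exact (hm.pow_const 2).aemeasurable

end Fourier
-- The embedding of `B'` in `H`
section DualEmbed

variable {H B : Type*} [NormedAddCommGroup H] [InnerProductSpace ℝ H] [CompleteSpace H]
  [NormedAddCommGroup B] [NormedSpace ℝ B] {i : H →L[ℝ] B}

theorem inner_dualEmbed (i : H →L[ℝ] B) (u : StrongDual ℝ B) (x : H) :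
    ⟪dualEmbed i u, x⟫ = u (i x) := by
  simp [dualEmbed]

theorem dualEmbed_injective (hi : DenseRange i) : Function.Injective (dualEmbed i) := by
  intro u v huv
  refine ContinuousLinearMap.coeFn_injective (hi.equalizer u.continuous v.continuous ?_)
  funext x
  simp only [Function.comp_apply, ← inner_dualEmbed, huv]

theorem denseRange_dualEmbed (hi : Function.Injective i) : DenseRange (dualEmbed i) := by
  have h : (LinearMap.range (dualEmbed i)).topologicalClosure = ⊤ := by
    rw [Submodule.topologicalClosure_eq_top_iff, Submodule.eq_bot_iff]
    intro x hx
    -- A vector `x` orthogonal to the range has `u (i x) = 0` for every `u`, so `i x = 0` by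
    -- Hahn–Banach.
    apply hi
    rw [map_zero]
    refine SeparatingDual.eq_zero_of_forall_dual_eq_zero (R := ℝ) fun u => ?_
    rw [← inner_dualEmbed]
    exact (Submodule.mem_orthogonal _ _).1 hx _ ⟨u, rfl⟩
  have := Submodule.dense_iff_topologicalClosure_eq_top.2 h
  rwa [LinearMap.coe_range] at this

end DualEmbed

/-! ### Wiener measures and their characteristic functional -/

section WienerMeasure

variable {H B : Type*} [NormedAddCommGroup H] [InnerProductSpace ℝ H] [CompleteSpace H]
  [NormedAddCommGroup B] [NormedSpace ℝ B] [MeasurableSpace B] [BorelSpace B]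
  {i : H →L[ℝ] B} {h : ℝ} {μ : Measure B}

omit [CompleteSpace H] [MeasurableSpace B] [BorelSpace B] in
theorem secondCountableTopology_of_denseRange [TopologicalSpace.SeparableSpace H]
    (hi : DenseRange i) : SecondCountableTopology B := by
  have := hi.separableSpace i.continuous
  exact UniformSpace.secondCountable_of_separable B

theorem IsWienerMeasure.isProbabilityMeasure (hμ : IsWienerMeasure i h μ) :
    IsProbabilityMeasure μ := by
  -- The empty orthonormal system already forces total mass 1.
  have h0 := hμ 0 Fin.elim0 ⟨fun j => j.elim0, fun j => j.elim0⟩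
  constructor
  have h1 : (μ.map (fun (x : B) (j : Fin 0) =>
      (Fin.elim0 j : StrongDual ℝ B) x)) Set.univ = 1 := by
    rw [h0]
    exact measure_univ
  rwa [Measure.map_apply (by fun_prop) MeasurableSet.univ, Set.preimage_univ] at h1

theorem IsWienerMeasure.map_eq_gaussianReal (hi : DenseRange i)
    (hμ : IsWienerMeasure i h μ) (u : StrongDual ℝ B) :
    μ.map u = gaussianReal 0 (‖dualEmbed i u‖₊ ^ 2 * h.toNNReal) := by
  have := hμ.isProbabilityMeasure
  by_cases hu : dualEmbed i u = 0
  · have hu0 : u = 0 := dualEmbed_injective hi (by rw [hu, map_zero])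
    have h1 : ⇑u = fun _ : B => (0 : ℝ) := by rw [hu0]; rfl
    rw [h1, Measure.map_const]
    simp [hu]
  · set c := ‖dualEmbed i u‖ with hc
    have hc0 : c ≠ 0 := norm_ne_zero_iff.2 hu
    set v : StrongDual ℝ B := c⁻¹ • u with hv
    have hon : Orthonormal ℝ (fun _ : Fin 1 => dualEmbed i v) := by
      refine ⟨fun _ => ?_, fun a b hab => (hab (Subsingleton.elim a b)).elim⟩
      rw [hv, map_smul, norm_smul, norm_inv, Real.norm_eq_abs, abs_norm, ← hc,
        inv_mul_cancel₀ hc0]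
    have h1 := congrArg (Measure.map (fun f : Fin 1 → ℝ => f 0)) (hμ 1 (fun _ => v) hon)
    rw [(measurePreserving_eval (fun _ : Fin 1 => gaussianReal 0 h.toNNReal) 0).map_eq,
      Measure.map_map (by fun_prop) (by fun_prop)] at h1
    have h2 : ⇑u = (fun r : ℝ => c * r) ∘ ((fun f : Fin 1 → ℝ => f 0) ∘
        fun (x : B) (_ : Fin 1) => v x) := by
      funext x
      simp [hv, mul_inv_cancel_left₀ hc0]
    rw [h2, ← Measure.map_map (by fun_prop) (by fun_prop), h1, gaussianReal_map_const_mul,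
      mul_zero]
    congr 2

theorem IsWienerMeasure.charFunDual_eq (hi : DenseRange i) (hh : 0 ≤ h)
    (hμ : IsWienerMeasure i h μ) (u : StrongDual ℝ B) :
    charFunDual μ u = Complex.exp (-(h * ‖dualEmbed i u‖ ^ 2 / 2 : ℝ)) := by
  rw [charFunDual_eq_charFun_map_one, hμ.map_eq_gaussianReal hi, charFun_gaussianReal]
  congr 1
  push_cast
  simp [hh]
  ring

/-- On an orthonormal system |∑ aⱼuⱼ|² = ∑ aⱼ², so the characteristic functional of the joint law
factorises into those of N(0,h). -/
theorem isWienerMeasure_of_charFunDual_eq [IsProbabilityMeasure μ] (hh : 0 ≤ h)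
    (hμ : ∀ u : StrongDual ℝ B,
      charFunDual μ u = Complex.exp (-(h * ‖dualEmbed i u‖ ^ 2 / 2 : ℝ))) :
    IsWienerMeasure i h μ := by
  intro n u hu
  have : IsFiniteMeasure (μ.map (fun (x : B) (j : Fin n) => u j x)) := inferInstance
  rw [← charFunDual_eq_pi_iff]
  intro L
  set T : B →L[ℝ] (Fin n → ℝ) := ContinuousLinearMap.pi u with hT
  have h1 : (fun (x : B) (j : Fin n) => u j x) = T := rfl
  rw [h1, charFunDual_map, hμ]
  set a : Fin n → ℝ := fun j => L (Pi.single j 1) with ha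
  have h2 : L.comp T = ∑ j, a j • u j := by
    ext x
    have : T x = ∑ j, (u j x) • (Pi.single j (1 : ℝ) : Fin n → ℝ) := by
      ext k
      simp [hT, Finset.sum_apply, Pi.single_apply]
    simp [this, ha, mul_comm]
  have h3 : ‖dualEmbed i (L.comp T)‖ ^ 2 = ∑ j, a j ^ 2 := by
    rw [h2, map_sum, ← real_inner_self_eq_norm_sq]
    simp_rw [map_smul]
    rw [hu.inner_sum]
    simp [sq]
  rw [h3]
  have h4 : ∀ j, charFunDual (gaussianReal 0 h.toNNReal)
      (L.comp (ContinuousLinearMap.single ℝ (fun _ : Fin n => ℝ) j)) =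
      Complex.exp (-(h * a j ^ 2 / 2 : ℝ)) := by
    intro j
    have h5 : L.comp (ContinuousLinearMap.single ℝ (fun _ : Fin n => ℝ) j) =
        InnerProductSpace.toDualMap ℝ ℝ (a j) := by
      ext
      simp [ha]
    rw [h5, ← charFun_eq_charFunDual_toDualMap, charFun_gaussianReal]
    congr 1
    push_cast
    simp [hh]
  simp_rw [h4]
  rw [← Complex.exp_sum]
  congr 1
  push_cast
  rw [Finset.sum_neg_distrib, Finset.mul_sum, Finset.sum_div]

theorem IsWienerMeasure.isGaussian (hi : DenseRange i)
    (hμ : IsWienerMeasure i h μ) : IsGaussian μ := by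
  refine isGaussian_of_isGaussian_map fun u => ?_
  rw [hμ.map_eq_gaussianReal hi]
  infer_instance

end WienerMeasure

/-! ### Uniqueness, and the bound on ℓ -/

section Uniqueness

variable {H B : Type*} [NormedAddCommGroup H] [InnerProductSpace ℝ H] [CompleteSpace H]
  [TopologicalSpace.SeparableSpace H]
  [NormedAddCommGroup B] [NormedSpace ℝ B] [CompleteSpace B] [MeasurableSpace B] [BorelSpace B]
  {i : H →L[ℝ] B} {h : ℝ} {μ μ' : Measure B}

theorem IsWienerMeasure.unique (hi : DenseRange i) (hh : 0 ≤ h)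
    (hμ : IsWienerMeasure i h μ) (hμ' : IsWienerMeasure i h μ') : μ = μ' := by
  have := secondCountableTopology_of_denseRange hi
  have := hμ.isProbabilityMeasure
  have := hμ'.isProbabilityMeasure
  refine Measure.ext_of_charFunDual (funext fun u => ?_)
  rw [hμ.charFunDual_eq hi hh, hμ'.charFunDual_eq hi hh]

theorem IsWienerMeasure.norm_toLp (hi : DenseRange i) (hh : 0 ≤ h)
    (hμ : IsWienerMeasure i h μ) (u : StrongDual ℝ B) :
    ‖StrongDual.toLp μ 2 u‖ = Real.sqrt h * ‖dualEmbed i u‖ := by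
  have := secondCountableTopology_of_denseRange hi
  have := hμ.isProbabilityMeasure
  have := hμ.isGaussian hi
  -- `StrongDual.toLp` is the actual inclusion only once the identity is in L²; Gaussianity of `μ`
  -- ensures this.
  have hid : MemLp id 2 μ := IsGaussian.memLp_two_id
  have hu : MemLp u 2 μ := hid.continuousLinearMap_comp u
  have hmean : ∫ x, u x ∂μ = 0 := by
    have h1 : ∫ x, x ∂(μ.map u) = 0 := by
      rw [hμ.map_eq_gaussianReal hi, integral_id_gaussianReal]
    rwa [integral_map (by fun_prop) (by fun_prop)] at h1
  have hvar : ∫ x, u x ^ 2 ∂μ = h * ‖dualEmbed i u‖ ^ 2 := by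
    rw [← variance_of_integral_eq_zero (by fun_prop) hmean]
    have h1 : Var[id; μ.map u] = Var[u; μ] := by
      rw [variance_map (by fun_prop) (by fun_prop)]
      rfl
    rw [← h1, hμ.map_eq_gaussianReal hi, variance_id_gaussianReal]
    simp [hh, mul_comm]
  have h2 : ‖StrongDual.toLp μ 2 u‖ ^ 2 = h * ‖dualEmbed i u‖ ^ 2 := by
    rw [← real_inner_self_eq_norm_sq, L2.inner_def, ← hvar]
    refine integral_congr_ae ?_
    rw [StrongDual.toLp_apply hid]
    filter_upwards [hu.coeFn_toLp] with x hx
    rw [hx]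
    simp [sq]
  rw [← Real.sqrt_sq (norm_nonneg (dualEmbed i u)), ← Real.sqrt_mul hh, ← h2,
    Real.sqrt_sq (norm_nonneg _)]

theorem IsWienerMeasure.norm_ell_le (hinj : Function.Injective i) (hi : DenseRange i)
    (hh : 0 ≤ h) (hμ : IsWienerMeasure i h μ) (a : H) :
    ‖ell i μ a‖ ≤ Real.sqrt h * ‖a‖ :=
  LinearMap.norm_extendOfNorm_apply_le (denseRange_dualEmbed hinj) _
    (fun u => (hμ.norm_toLp hi hh u).le) a

end Uniqueness

/-! ### Exhausting subspaces and Gaussians on them -/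

section Existence

variable {H : Type*} [NormedAddCommGroup H] [InnerProductSpace ℝ H]

theorem exists_monotone_finiteDimensional_dense [TopologicalSpace.SeparableSpace H]
    (F : ℕ → Submodule ℝ H) [∀ n, FiniteDimensional ℝ (F n)] :
    ∃ G : ℕ → Submodule ℝ H, (∀ n, FiniteDimensional ℝ (G n)) ∧ Monotone G ∧ G 0 = ⊥ ∧
      (∀ n, F n ≤ G (n + 1)) ∧ Dense (⋃ n, (G n : Set H)) := by
  let d := TopologicalSpace.denseSeq H
  let K : ℕ → Submodule ℝ H := fun n => F n ⊔ ℝ ∙ d n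
  have hK : ∀ n, K n ≤ (Finset.range (n + 1)).sup K := fun n =>
    Finset.le_sup (f := K) (Finset.self_mem_range_succ n)
  refine ⟨fun n => (Finset.range n).sup K, fun n => ?_, fun m n hmn => ?_, by simp,
    fun n => le_sup_left.trans (hK n), ?_⟩
  · exact Submodule.finiteDimensional_finset_sup _ _
  · exact Finset.sup_mono (Finset.range_mono hmn)
  · refine (TopologicalSpace.denseRange_denseSeq H).mono ?_
    rintro _ ⟨n, rfl⟩
    refine Set.mem_iUnion.2 ⟨n + 1, hK n ?_⟩
    exact (le_sup_right : ℝ ∙ d n ≤ K n) (Submodule.mem_span_singleton_self _)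

theorem tendsto_starProjection_of_dense [CompleteSpace H] (G : ℕ → Submodule ℝ H)
    [∀ n, FiniteDimensional ℝ (G n)] (hG : Monotone G) (hd : Dense (⋃ n, (G n : Set H))) (x : H) :
    Tendsto (fun n => (G n).starProjection x) atTop (𝓝 x) := by
  refine Submodule.starProjection_tendsto_self G hG x ?_
  intro y _
  rw [← SetLike.mem_coe, Submodule.topologicalClosure_coe,
    Submodule.coe_iSup_of_directed _ hG.directed_le]
  exact hd y

theorem norm_starProjection_sq_eq_add (G G' : Submodule ℝ H) (hGG : G ≤ G')
    [FiniteDimensional ℝ G] [FiniteDimensional ℝ G'] (x : H) :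
    ‖G'.starProjection x‖ ^ 2 =
      ‖G.starProjection x‖ ^ 2 + ‖(G' ⊓ Gᗮ).starProjection x‖ ^ 2 := by
  have h1 : G'.starProjection x - G.starProjection x ∈ G' ⊓ Gᗮ := by
    refine ⟨sub_mem (Submodule.starProjection_apply_mem _ _)
      (hGG (Submodule.starProjection_apply_mem _ _)), ?_⟩
    have h2 := sub_mem (Submodule.sub_starProjection_mem_orthogonal (K := G) x)
      (Submodule.orthogonal_le hGG (Submodule.sub_starProjection_mem_orthogonal (K := G') x))
    rwa [sub_sub_sub_cancel_left] at h2
  have h3 : (G' ⊓ Gᗮ).starProjection x = G'.starProjection x - G.starProjection x := by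
    refine Submodule.eq_starProjection_of_mem_of_inner_eq_zero h1 fun w hw => ?_
    rw [← sub_add, inner_add_left,
      Submodule.starProjection_inner_eq_zero x w hw.1, zero_add]
    exact hw.2 _ (Submodule.starProjection_apply_mem _ _)
  have h4 : G'.starProjection x = G.starProjection x + (G' ⊓ Gᗮ).starProjection x := by
    rw [h3]; abel
  rw [h4, sq, sq, sq]
  refine norm_add_sq_eq_norm_sq_add_norm_sq_real ?_
  rw [h3]
  exact h1.2 _ (Submodule.starProjection_apply_mem _ _)

variable [MeasurableSpace H] [BorelSpace H]

instance isProbabilityMeasure_gaussianOn (E : Submodule ℝ H) [FiniteDimensional ℝ E] (h : ℝ) :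
    IsProbabilityMeasure (gaussianOn E h) :=
  Measure.isProbabilityMeasure_map (by fun_prop)

theorem charFun_gaussianOn (E : Submodule ℝ H) [FiniteDimensional ℝ E] {h : ℝ} (hh : 0 ≤ h)
    (t : E) : charFun (gaussianOn E h) t = Complex.exp (-(h * ‖t‖ ^ 2 / 2 : ℝ)) := by
  rw [gaussianOn, charFun_map_smul, charFun_stdGaussian, norm_smul, Real.norm_eq_abs,
    abs_of_nonneg (Real.sqrt_nonneg h)]
  congr 1
  norm_cast
  rw [mul_pow, Real.sq_sqrt hh]
  ring

theorem integral_exp_inner_gaussianOn (E : Submodule ℝ H) [FiniteDimensional ℝ E] {h : ℝ}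
    (hh : 0 ≤ h) (a : H) :
    ∫ y : E, Complex.exp ((⟪a, (y : H)⟫ : ℝ) * Complex.I) ∂(gaussianOn E h) =
      Complex.exp (-(h * ‖E.starProjection a‖ ^ 2 / 2 : ℝ)) := by
  have h1 : ‖E.starProjection a‖ = ‖E.orthogonalProjectionOnto a‖ := by
    rw [Submodule.starProjection_apply, Submodule.coe_norm]
  rw [h1, ← charFun_gaussianOn E hh, charFun_apply]
  refine integral_congr_ae (ae_of_all _ fun y => ?_)
  simp only
  rw [Submodule.inner_orthogonalProjectionOnto_eq_of_mem_left, real_inner_comm]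

end Existence

/-! ### Existence of the Wiener measure -/

section WienerExistence

variable {H B : Type*} [NormedAddCommGroup H] [InnerProductSpace ℝ H]
  [MeasurableSpace H] [BorelSpace H]
  [NormedAddCommGroup B] [NormedSpace ℝ B] {i : H →L[ℝ] B}

omit [BorelSpace H] in
theorem IsAbstractWienerSpace.exists_increments [TopologicalSpace.SeparableSpace H]
    [CompleteSpace H] (hi : IsAbstractWienerSpace i) {h : ℝ} (hh : 0 < h) :
    ∃ (E : ℕ → Submodule ℝ H) (_ : ∀ n, FiniteDimensional ℝ (E n)),
      (∀ n, gaussianOn (E (n + 1)) h {y | (1 / 2 : ℝ) ^ n < ‖i (y : H)‖} ≤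
        ENNReal.ofReal ((1 / 2 : ℝ) ^ n)) ∧
      ∀ a : H, Tendsto (fun n => ∑ k ∈ Finset.range n, ‖(E k).starProjection a‖ ^ 2) atTop
        (𝓝 (‖a‖ ^ 2)) := by
  choose F hFfin hF using fun n : ℕ =>
    hi.measurable_norm ((1 / 2 : ℝ) ^ n) h (by positivity) hh
  obtain ⟨G, hGfin, hGmono, hG0, hFG, hGd⟩ := exists_monotone_finiteDimensional_dense F
  -- Increment n + 1 is orthogonal to `G (n + 1)`, hence to `F n`: this is the shift in the
  -- estimate, and increment 0 is not controlled. The squared norms telescope because `G 0 = ⊥`.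
  refine ⟨fun n => G (n + 1) ⊓ (G n)ᗮ, fun n => inferInstance, fun n => ?_, fun a => ?_⟩
  · refine (hF n _ ?_).le
    rw [Submodule.isOrtho_iff_le]
    exact inf_le_right.trans (Submodule.orthogonal_le (hFG n))
  · have h1 : ∀ n, ∑ k ∈ Finset.range n, ‖(G (k + 1) ⊓ (G k)ᗮ).starProjection a‖ ^ 2 =
        ‖(G n).starProjection a‖ ^ 2 := by
      intro n
      induction n with
      | zero => simp [hG0]
      | succ n ih =>
        rw [Finset.sum_range_succ, ih,
          norm_starProjection_sq_eq_add (G n) (G (n + 1)) (hGmono n.le_succ)]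
    simp_rw [h1]
    exact ((tendsto_starProjection_of_dense G hGmono hGd a).norm).pow 2

omit [NormedSpace ℝ B] in
theorem ae_summable_of_measure_norm_gt_le [CompleteSpace B] {Ω : Type*} [MeasurableSpace Ω]
    (P : Measure Ω) (X : ℕ → Ω → B)
    (hX : ∀ n, P {ω | (1 / 2 : ℝ) ^ n < ‖X (n + 1) ω‖} ≤ ENNReal.ofReal ((1 / 2 : ℝ) ^ n)) :
    ∀ᵐ ω ∂P, Summable fun n => X n ω := by
  have h1 : ∑' n, P {ω | (1 / 2 : ℝ) ^ n < ‖X (n + 1) ω‖} ≠ ∞ := by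
    refine ne_top_of_le_ne_top ?_ (ENNReal.tsum_le_tsum hX)
    rw [← ENNReal.ofReal_tsum_of_nonneg (fun n => by positivity) summable_geometric_two]
    exact ENNReal.ofReal_ne_top
  filter_upwards [ae_eventually_notMem h1] with ω hω
  rw [← summable_nat_add_iff 1]
  refine Summable.of_norm_bounded_eventually_nat (g := fun n => (1 / 2 : ℝ) ^ n)
    summable_geometric_two ?_
  filter_upwards [hω] with n hn
  simpa using hn

variable [CompleteSpace H] [TopologicalSpace.SeparableSpace H] [CompleteSpace B]
  [MeasurableSpace B] [BorelSpace B]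

theorem integral_exp_sum_infinitePi_gaussianOn (E : ℕ → Submodule ℝ H)
    [∀ n, FiniteDimensional ℝ (E n)] {h : ℝ} (hh : 0 ≤ h) (a : H) (n : ℕ) :
    ∫ ω, Complex.exp ((∑ k ∈ Finset.range n, ⟪a, (ω k : H)⟫ : ℝ) * Complex.I)
        ∂(Measure.infinitePi fun k => gaussianOn (E k) h) =
      Complex.exp (-(h * (∑ k ∈ Finset.range n, ‖(E k).starProjection a‖ ^ 2) / 2 : ℝ)) := by
  set P := Measure.infinitePi fun k => gaussianOn (E k) h with hP
  let Y : ℕ → (Π k, E k) → ℝ := fun k ω => ⟪a, (ω k : H)⟫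
  have hY : ∀ k, Measurable (Y k) := fun k => by fun_prop
  have hind : iIndepFun Y P :=
    iIndepFun_infinitePi (X := fun k (y : E k) => ⟪a, (y : H)⟫) fun k => by fun_prop
  have h1 := congrFun (iIndepFun.charFun_map_fun_finsetSum_eq_prod (s := Finset.range n)
    (fun k _ => (hY k).aemeasurable) (hind.restrict _)) 1
  rw [charFun_apply_real, integral_map (by fun_prop) (by fun_prop), Finset.prod_apply] at h1
  simp only [Complex.ofReal_one, one_mul] at h1
  refine h1.trans ?_
  have h2 : ∀ k, charFun (P.map (Y k)) 1 =
      Complex.exp (-(h * ‖(E k).starProjection a‖ ^ 2 / 2 : ℝ)) := by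
    intro k
    have h3 : P.map (Y k) = (gaussianOn (E k) h).map (fun y : E k => ⟪a, (y : H)⟫) := by
      rw [← Measure.infinitePi_map_eval (fun k => gaussianOn (E k) h) k,
        Measure.map_map (by fun_prop) (by fun_prop)]
      rfl
    rw [h3, charFun_apply_real, integral_map (by fun_prop) (by fun_prop),
      ← integral_exp_inner_gaussianOn (E k) hh]
    simp
  simp_rw [h2]
  rw [← Complex.exp_sum]
  congr 1
  push_cast
  rw [Finset.sum_neg_distrib, Finset.mul_sum, Finset.sum_div]

theorem IsAbstractWienerSpace.exists_isWienerMeasure (hi : IsAbstractWienerSpace i) {h : ℝ}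
    (hh : 0 < h) : ∃ μ : Measure B, IsWienerMeasure i h μ := by
  have := secondCountableTopology_of_denseRange hi.denseRange
  obtain ⟨E, hEfin, hE, hEsum⟩ := hi.exists_increments hh
  set P := Measure.infinitePi fun k => gaussianOn (E k) h with hP
  let X : ℕ → (Π k, E k) → B := fun k ω => i (ω k : H)
  have hXm : ∀ k, Measurable (X k) := fun k => by fun_prop
  have hsum : ∀ᵐ ω ∂P, Summable fun n => X n ω := by
    refine ae_summable_of_measure_norm_gt_le P X fun n => (le_of_eq ?_).trans (hE n)
    rw [← Measure.infinitePi_map_eval (fun k => gaussianOn (E k) h) (n + 1),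
      Measure.map_apply (by fun_prop) (measurableSet_lt (by fun_prop) (by fun_prop))]
    rfl
  let S : (Π k, E k) → B := fun ω => ∑' n, X n ω
  have hlim : ∀ᵐ ω ∂P, Tendsto (fun n => ∑ k ∈ Finset.range n, X k ω) atTop (𝓝 (S ω)) := by
    filter_upwards [hsum] with ω hω using hω.hasSum.tendsto_sum_nat
  have hS : AEMeasurable S P :=
    aemeasurable_of_tendsto_metrizable_ae atTop (fun n => by fun_prop) hlim
  have : IsProbabilityMeasure (P.map S) := Measure.isProbabilityMeasure_map hS
  refine ⟨P.map S, isWienerMeasure_of_charFunDual_eq hh.le fun u => ?_⟩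
  rw [charFunDual_apply, integral_map hS (by fun_prop)]
  have h1 : Tendsto (fun n => ∫ ω, Complex.exp
      ((∑ k ∈ Finset.range n, ⟪dualEmbed i u, (ω k : H)⟫ : ℝ) * Complex.I) ∂P) atTop
      (𝓝 (∫ ω, Complex.exp (u (S ω) * Complex.I) ∂P)) := by
    refine tendsto_integral_of_dominated_convergence (fun _ => 1)
      (fun n => Measurable.aestronglyMeasurable (by fun_prop)) (integrable_const _)
      (fun n => ae_of_all _ fun ω => (Complex.norm_exp_ofReal_mul_I _).le) ?_
    filter_upwards [hlim] with ω hω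
    have h2 : Tendsto (fun n => u (∑ k ∈ Finset.range n, X k ω)) atTop (𝓝 (u (S ω))) :=
      (u.continuous.tendsto _).comp hω
    have h3 : ∀ n, u (∑ k ∈ Finset.range n, X k ω) =
        ∑ k ∈ Finset.range n, ⟪dualEmbed i u, (ω k : H)⟫ := by
      intro n
      rw [map_sum]
      simp_rw [inner_dualEmbed]
      rfl
    simp_rw [h3] at h2
    have h4 : Continuous fun r : ℝ => Complex.exp (r * Complex.I) := by fun_prop
    exact (h4.tendsto _).comp h2
  -- The same integrals, computed by independence, are exp(-h/2 times the partial sums), and these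
  -- sums tend to |u|².
  refine tendsto_nhds_unique h1 ?_
  simp_rw [hP, integral_exp_sum_infinitePi_gaussianOn E hh.le]
  have h5 : Continuous fun r : ℝ => Complex.exp (-(h * r / 2 : ℝ)) := by fun_prop
  exact (h5.tendsto _).comp (hEsum _)

end WienerExistence

/-! ### Stochastic extension of the Fourier transform -/

section Extension

theorem eLpNorm_two_sq {Ω F : Type*} [MeasurableSpace Ω] [NormedAddCommGroup F] (μ : Measure Ω)
    (f : Ω → F) : eLpNorm f 2 μ ^ 2 = ∫⁻ x, ‖f x‖ₑ ^ 2 ∂μ := by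
  have h := eLpNorm_nnreal_pow_eq_lintegral (μ := μ) (f := f) (p := 2) two_ne_zero
  simpa using h

variable {H B : Type*} [NormedAddCommGroup H] [InnerProductSpace ℝ H] [CompleteSpace H]
  [MeasurableSpace H]
  [NormedAddCommGroup B] [NormedSpace ℝ B] [MeasurableSpace B] [BorelSpace B]
  {i : H →L[ℝ] B} {h : ℝ} {μ : Measure B}

omit [MeasurableSpace H] in
theorem inner_projExt_ae_eq (i : H →L[ℝ] B) (μ : Measure B) (E : Submodule ℝ H)
    [FiniteDimensional ℝ E] (a : H) :
    (fun x => ⟪a, projExt i μ E x⟫) =ᵐ[μ] (ell i μ (E.starProjection a) : B → ℝ) := by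
  set b := stdOrthonormalBasis ℝ E
  have h1 : ell i μ (E.starProjection a) = ∑ j, ⟪(b j : H), a⟫ • ell i μ (b j : H) := by
    rw [b.starProjection_eq_sum_rankOne]
    simp
  rw [h1]
  have h2 : ∀ᵐ x ∂μ, ∀ j, (⟪(b j : H), a⟫ • ell i μ (b j : H) : Lp ℝ 2 μ) x =
      ⟪(b j : H), a⟫ * (ell i μ (b j : H) : B → ℝ) x :=
    ae_all_iff.2 fun j => by
      filter_upwards [Lp.coeFn_smul ⟪(b j : H), a⟫ (ell i μ (b j : H))] with x hx using hx
  filter_upwards [Lp.coeFn_fun_finsetSum Finset.univ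
    (fun j => ⟪(b j : H), a⟫ • ell i μ (b j : H)), h2] with x hx hx2
  rw [hx]
  simp_rw [hx2]
  rw [projExt, inner_sum]
  refine Finset.sum_congr rfl fun j _ => ?_
  rw [inner_smul_right, real_inner_comm, mul_comm]

variable [BorelSpace H] [TopologicalSpace.SeparableSpace H]

theorem measurable_projExt (i : H →L[ℝ] B) (μ : Measure B) (E : Submodule ℝ H)
    [FiniteDimensional ℝ E] : Measurable (projExt i μ E) := by
  have := UniformSpace.secondCountable_of_separable H
  unfold projExt
  refine Finset.measurable_sum _ fun j _ => ?_
  exact (Lp.stronglyMeasurable _).measurable.smul_const _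

variable [CompleteSpace B]

omit [BorelSpace H] in
-- The bound 4 is the integrable dominant over `u`; the other bound supplies the pointwise limit 0.
theorem lintegral_exp_inner_projExt_sub_sq_le (hi : IsAbstractWienerSpace i) (hh : 0 ≤ h)
    (hμ : IsWienerMeasure i h μ) (E F : Submodule ℝ H) [FiniteDimensional ℝ E]
    [FiniteDimensional ℝ F] (u : H) :
    ∫⁻ x, ‖Complex.exp (Complex.I * (⟪u, projExt i μ E x⟫ : ℝ)) -
        Complex.exp (Complex.I * (⟪u, projExt i μ F x⟫ : ℝ))‖ₑ ^ 2 ∂μ ≤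
      min 4 (ENNReal.ofReal (Real.sqrt h * ‖E.starProjection u - F.starProjection u‖) ^ 2) := by
  have := hμ.isProbabilityMeasure
  refine le_min ?_ ?_
  · calc _ ≤ ∫⁻ _, 4 ∂μ := by
          refine lintegral_mono fun x => ?_
          have h1 : ‖Complex.exp (Complex.I * (⟪u, projExt i μ E x⟫ : ℝ)) -
              Complex.exp (Complex.I * (⟪u, projExt i μ F x⟫ : ℝ))‖ₑ ≤ 2 := by
            refine (enorm_sub_le).trans (le_of_eq ?_)
            rw [← ofReal_norm, ← ofReal_norm, norm_exp_I_mul_ofReal, norm_exp_I_mul_ofReal]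
            norm_num
          grw [h1]
          norm_num
      _ = 4 := by simp
  · calc _ ≤ ∫⁻ x, ‖(ell i μ (E.starProjection u - F.starProjection u) : B → ℝ) x‖ₑ ^ 2 ∂μ := by
          refine lintegral_mono_ae ?_
          rw [map_sub]
          filter_upwards [inner_projExt_ae_eq i μ E u, inner_projExt_ae_eq i μ F u,
            Lp.coeFn_sub (ell i μ (E.starProjection u)) (ell i μ (F.starProjection u))]
            with x hx hx' hx''
          rw [hx'', Pi.sub_apply, ← hx, ← hx']
          gcongr
          rw [← ofReal_norm, ← ofReal_norm]
          exact ENNReal.ofReal_le_ofReal (norm_exp_I_mul_ofReal_sub_le _ _)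
      _ = ‖ell i μ (E.starProjection u - F.starProjection u)‖ₑ ^ 2 := by
          rw [← eLpNorm_two_sq, Lp.enorm_def]
      _ ≤ _ := by
          gcongr
          rw [← ofReal_norm]
          exact ENNReal.ofReal_le_ofReal (hμ.norm_ell_le hi.injective hi.denseRange hh _)

omit [CompleteSpace B] in
theorem memLp_fourierMeasure_projExt [IsProbabilityMeasure μ] (i : H →L[ℝ] B)
    (ν : ComplexMeasure H) (E : Submodule ℝ H) [FiniteDimensional ℝ E] (p : ℝ≥0∞) :
    MemLp (fun x => fourierMeasure ν (projExt i μ E x)) p μ :=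
  MemLp.of_bound (((continuous_fourierMeasure ν).measurable.comp
    (measurable_projExt i μ E)).aestronglyMeasurable) _
    (ae_of_all _ fun _ => norm_fourierMeasure_le ν _)

/-- Two sequences and two indices serve both purposes: `E = F` gives the Cauchy property, and the
diagonal with `E ≠ F` shows that the limit is independent of the sequence. -/
theorem tendsto_eLpNorm_fourierMeasure_projExt_sub (hi : IsAbstractWienerSpace i) (hh : 0 ≤ h)
    (hμ : IsWienerMeasure i h μ) (ν : ComplexMeasure H) (E F : ℕ → Submodule ℝ H)
    [∀ n, FiniteDimensional ℝ (E n)] [∀ n, FiniteDimensional ℝ (F n)]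
    (hE : Monotone E) (hF : Monotone F) (hEd : Dense (⋃ n, (E n : Set H)))
    (hFd : Dense (⋃ n, (F n : Set H))) :
    Tendsto (fun n : ℕ × ℕ => eLpNorm (fun x => fourierMeasure ν (projExt i μ (E n.1) x) -
      fourierMeasure ν (projExt i μ (F n.2) x)) 2 μ) atTop (𝓝 0) := by
  have := UniformSpace.secondCountable_of_separable H
  have := hμ.isProbabilityMeasure
  let D : ℕ × ℕ → H → ℝ≥0∞ := fun n u => min 4 (ENNReal.ofReal
    (Real.sqrt h * ‖(E n.1).starProjection u - (F n.2).starProjection u‖) ^ 2)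
  have hD : Tendsto (fun n => ∫⁻ u, D n u ∂ν.variation) atTop (𝓝 0) := by
    have h1 : Tendsto (fun n => ∫⁻ u, D n u ∂ν.variation) atTop
        (𝓝 (∫⁻ _, 0 ∂ν.variation)) := by
      refine tendsto_lintegral_filter_of_dominated_convergence (fun _ => 4)
        (Eventually.of_forall fun n => by fun_prop)
        (Eventually.of_forall fun n => ae_of_all _ fun u => min_le_left _ _) ?_
        (ae_of_all _ fun u => ?_)
      · rw [lintegral_const]
        exact ENNReal.mul_ne_top (by simp) (measure_ne_top _ _)
      · have h2 : Tendsto (fun n : ℕ × ℕ =>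
            (E n.1).starProjection u - (F n.2).starProjection u) atTop (𝓝 (u - u)) := by
          rw [← prod_atTop_atTop_eq]
          exact ((tendsto_starProjection_of_dense E hE hEd u).comp tendsto_fst).sub
            ((tendsto_starProjection_of_dense F hF hFd u).comp tendsto_snd)
        have h3 : Continuous fun x : H => min (4 : ℝ≥0∞)
            (ENNReal.ofReal (Real.sqrt h * ‖x‖) ^ 2) := by
          refine continuous_const.min ((ENNReal.continuous_pow 2).comp ?_)
          exact ENNReal.continuous_ofReal.comp (by fun_prop)
        have h4 := (h3.tendsto _).comp h2
        rw [sub_self, norm_zero, mul_zero, ENNReal.ofReal_zero, zero_pow two_ne_zero,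
          min_eq_right zero_le] at h4
        exact h4
    simpa using h1
  have hsq : Tendsto (fun n : ℕ × ℕ => eLpNorm (fun x =>
      fourierMeasure ν (projExt i μ (E n.1) x) -
      fourierMeasure ν (projExt i μ (F n.2) x)) 2 μ ^ 2) atTop (𝓝 0) := by
    have h5 : Tendsto (fun n => ν.variation Set.univ * ∫⁻ u, D n u ∂ν.variation) atTop (𝓝 0) := by
      have := ENNReal.Tendsto.const_mul hD (Or.inr (measure_ne_top ν.variation Set.univ))
      rwa [mul_zero] at this
    refine tendsto_of_tendsto_of_tendsto_of_le_of_le tendsto_const_nhds h5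
      (fun _ => zero_le) fun n => ?_
    rw [eLpNorm_two_sq]
    refine (lintegral_fourierMeasure_sub_sq_le μ ν _ _ (measurable_projExt i μ _)
      (measurable_projExt i μ _)).trans ?_
    gcongr with u
    exact lintegral_exp_inner_projExt_sub_sq_le hi hh hμ _ _ u
  have h6 := (ENNReal.continuous_rpow_const (y := (1 / 2 : ℝ))).tendsto 0 |>.comp hsq
  simp only [Function.comp_def, ← ENNReal.rpow_natCast, ← ENNReal.rpow_mul] at h6
  simpa using h6

theorem exists_isLpStochasticExtension_fourierMeasure (hi : IsAbstractWienerSpace i)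
    (hh : 0 ≤ h) (hμ : IsWienerMeasure i h μ) (ν : ComplexMeasure H) :
    ∃ g : B → ℂ, IsLpStochasticExtension i μ 2 (fourierMeasure ν) g := by
  have := hμ.isProbabilityMeasure
  -- One reference sequence, built from a dense sequence of `H`, defines the limit `g`.
  obtain ⟨F, hFfin, hF, -, -, hFd⟩ :=
    exists_monotone_finiteDimensional_dense (fun _ : ℕ => (⊥ : Submodule ℝ H))
  have hmem := fun n => memLp_fourierMeasure_projExt (μ := μ) i ν (F n) 2
  have hcau : CauchySeq fun n => (hmem n).toLp := by
    rw [Lp.cauchySeq_Lp_iff_cauchySeq_eLpNorm]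
    refine (tendsto_eLpNorm_fourierMeasure_projExt_sub hi hh hμ ν F F hF hF hFd hFd).congr
      fun n => eLpNorm_congr_ae ?_
    filter_upwards [(hmem n.1).coeFn_toLp, (hmem n.2).coeFn_toLp] with x hx hx'
    rw [Pi.sub_apply, hx, hx']
  obtain ⟨g, hg⟩ := cauchySeq_tendsto_of_complete hcau
  rw [Lp.tendsto_Lp_iff_tendsto_eLpNorm'] at hg
  have hg' : Tendsto (fun n => eLpNorm (fun x => fourierMeasure ν (projExt i μ (F n) x) - g x)
      2 μ) atTop (𝓝 0) := by
    refine hg.congr fun n => eLpNorm_congr_ae ?_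
    filter_upwards [(hmem n).coeFn_toLp] with x hx
    rw [Pi.sub_apply, hx]
  refine ⟨g, (continuous_fourierMeasure ν).measurable, Lp.memLp g, fun E hEfin hE hEd =>
    ⟨fun n => memLp_fourierMeasure_projExt i ν (E n) 2, ?_⟩⟩
  have hdiag := (tendsto_eLpNorm_fourierMeasure_projExt_sub hi hh hμ ν E F hE hF hEd hFd).comp
    tendsto_atTop_diagonal
  have hadd := hdiag.add hg'
  rw [add_zero] at hadd
  refine tendsto_of_tendsto_of_tendsto_of_le_of_le tendsto_const_nhds hadd
    (fun _ => zero_le) fun n => ?_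
  have hEn := memLp_fourierMeasure_projExt (μ := μ) i ν (E n) 2
  calc eLpNorm (fun x => fourierMeasure ν (projExt i μ (E n) x) - g x) 2 μ
      = eLpNorm ((fun x => fourierMeasure ν (projExt i μ (E n) x) -
          fourierMeasure ν (projExt i μ (F n) x)) +
          fun x => fourierMeasure ν (projExt i μ (F n) x) - g x) 2 μ := by
        congr 1
        funext x
        simp
    _ ≤ _ := eLpNorm_add_le (hEn.sub (hmem n)).aestronglyMeasurable
        ((hmem n).sub (Lp.memLp g)).aestronglyMeasurable (by norm_num)

omit [BorelSpace H] [TopologicalSpace.SeparableSpace H] [CompleteSpace B] in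
theorem IsLpStochasticExtension.isStochasticExtension {p : ℝ≥0∞} (hp : p ≠ 0) {f : H → ℂ}
    {g : B → ℂ} (hg : IsLpStochasticExtension i μ p f g) : IsStochasticExtension i μ f g :=
  ⟨hg.1, hg.2.1.aestronglyMeasurable, fun E _ hE hEd =>
    tendstoInMeasure_of_tendsto_eLpNorm hp
      (fun n => ((hg.2.2 E hE hEd).1 n).aestronglyMeasurable) hg.2.1.aestronglyMeasurable
      (hg.2.2 E hE hEd).2⟩

end Extension

end AbstractWiener

theorem proposition8p6 {H B : Type*}
    [NormedAddCommGroup H] [InnerProductSpace ℝ H] [CompleteSpace H]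
    [TopologicalSpace.SeparableSpace H] [MeasurableSpace H] [BorelSpace H]
    [NormedAddCommGroup B] [NormedSpace ℝ B] [CompleteSpace B]
    [MeasurableSpace B] [BorelSpace B]
    (i : H →L[ℝ] B) (hi : AbstractWiener.IsAbstractWienerSpace i)
    (ν : ComplexMeasure H) (h : ℝ) (hh : 0 < h) :
    (∃! μ : Measure B, AbstractWiener.IsWienerMeasure i h μ) ∧
      ∀ μ : Measure B, AbstractWiener.IsWienerMeasure i h μ →
        ∃ g : B → ℂ,
          AbstractWiener.IsStochasticExtension i μ (AbstractWiener.fourierMeasure ν) g ∧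
          AbstractWiener.IsLpStochasticExtension i μ 2 (AbstractWiener.fourierMeasure ν) g := by
  refine ⟨?_, fun μ hμ => ?_⟩
  · obtain ⟨μ, hμ⟩ := hi.exists_isWienerMeasure hh
    exact ⟨μ, hμ, fun μ' hμ' => hμ'.unique hi.denseRange hh.le hμ⟩
  · obtain ⟨g, hg⟩ :=
      AbstractWiener.exists_isLpStochasticExtension_fourierMeasure hi hh.le hμ ν
    exact ⟨g, hg.isStochasticExtension two_ne_zero, hg⟩
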